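/- Let $\mathcal H$ be a separable complex Hilbert space. A conjugation on $\mathcal H$ is a bounded antilinear map $C:\mathcal H\to\mathcal H$ with $\|Cx\|=\|x\|$ for all $x$ and $C^2=I$. A spectral measure on the unit circle $\mathbb T$ is a map $E(\cdot)$ from the Borel subsets of $\mathbb T$ to the orthogonal projections on $\mathcal H$ such that $E(\mathbb T)=I$ and $E(\cdot)$ is countably additive in the strong operator topology. It is associated with the bounded operator $U$ if $U=\int_{\mathbb T}\xi\,dE(\xi)$, that is, $\langle Ux,y\rangle=\int_{\mathbb T}\xi\,d\langle E(\xi)x,y\rangle$ for all $x,y\in\mathcal H$; it is called the spectral measure of $U$ if, moreover, it is the only spectral measure associated with $U$. For a Borel set $\Omega\subseteq\mathbb T$ put $\Omega^*=\{\overline\xi:\xi\in\Omega\}$ and $E^c(\Omega)=E(\Omega^*)$. Let $C$ be a conjugation on $\mathcal H$ and let $U$ be a unitary operator on $\mathcal H$ with associated spectral measure $E(\cdot)$. Then: (a) $E^c(\cdot)$ is the spectral measure of $U^*$; (b) $CE(\cdot)C$ is the spectral measure of $CU^*C$; (c) $CUC=U^*$ if and only if $CE(\Omega)C=E(\Omega)$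 for all Borel sets $\Omega\subseteq\mathbb T$; (d) $CUC=U$ if and only if $CE(\Omega)C=E^c(\Omega)$ for all Borel sets $\Omega\subseteq\mathbb T$. -/

import Mathlib

open MeasureTheory
open scoped ComplexConjugate

noncomputable section

namespace SpectralConj

/-- The Borel sigma-algebra of the unit circle. -/
instance instMeasurableSpaceCircle : MeasurableSpace Circle := borel Circle

instance instBorelSpaceCircle : BorelSpace Circle := ⟨rfl⟩

variable {H : Type*} [NormedAddCommGroup H] [InnerProductSpace ℂ H]

/-- A conjugation on `H`: a bounded antilinear map that is isometric and involutive. -/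
structure IsConjugation (C : H →L⋆[ℂ] H) : Prop where
  isometric : ∀ x, ‖C x‖ = ‖x‖
  involutive : ∀ x, C (C x) = x

/-- The bounded linear operator `C A C`, for `C` bounded antilinear and `A` bounded linear. -/
def sandwich (C : H →L⋆[ℂ] H) (A : H →L[ℂ] H) : H →L[ℂ] H :=
  C.comp (A.comp C)

/-- The set `Ω^* = {conj ξ : ξ ∈ Ω}` of complex conjugates of the points of `Ω`. -/
def conjSet (Ω : Set Circle) : Set Circle :=
  {ζ | ∃ ξ ∈ Ω, (ζ : ℂ) = conj (ξ : ℂ)}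

variable [CompleteSpace H]

/-- `E` is a spectral measure on the unit circle: its values on Borel sets are orthogonal
projections, `E 𝕋 = I`, and it is countably additive (in the strong operator topology).
Only the values of `E` on Borel sets matter. -/
structure IsSpectralMeasure (E : Set Circle → H →L[ℂ] H) : Prop where
  isStarProjection : ∀ Ω, MeasurableSet Ω → IsStarProjection (E Ω)
  univ_eq : E Set.univ = ContinuousLinearMap.id ℂ H
  hasSum_iUnion : ∀ Ω : ℕ → Set Circle, (∀ n, MeasurableSet (Ω n)) →
    Pairwise (Function.onFun Disjoint Ω) →
    ∀ x, HasSum (fun n => E (Ω n) x) (E (⋃ n, Ω n) x)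

open Classical in
/-- The complex Borel measure `μ_{x,y}(Ω) = ⟨E(Ω) x, y⟩` of a spectral measure `E`. Mathlib's inner
product is linear in the second variable, so for `⟨·, ·⟩` linear in the first variable this is
`inner ℂ y (E Ω x)`. -/
def elementaryMeasure {E : Set Circle → H →L[ℂ] H} (hE : IsSpectralMeasure E) (x y : H) :
    ComplexMeasure Circle where
  measureOf' Ω := if MeasurableSet Ω then inner ℂ y (E Ω x) else 0
  empty' := by
    have h := hE.hasSum_iUnion (fun _ => ∅) (fun _ => MeasurableSet.empty)
      (fun _ _ _ => by simp [Function.onFun]) x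
    have h0 : E ∅ x = 0 := tendsto_const_nhds_iff.mp h.summable.tendsto_atTop_zero
    simp [h0]
  not_measurable' Ω hΩ := by simp [hΩ]
  m_iUnion' Ω hΩ hd := by
    have h := (hE.hasSum_iUnion Ω hΩ hd x).mapL (innerSL ℂ y)
    simpa [hΩ, MeasurableSet.iUnion hΩ] using h

/-- `E` is a spectral measure associated with the operator `U`, that is, `U = ∫ ξ dE(ξ)`:
`⟨U x, y⟩ = ∫ ξ d⟨E(ξ) x, y⟩` for all vectors `x, y`, the right-hand side being the integral of the
function `ξ ↦ ξ` against the complex measure `⟨E(·) x, y⟩`. -/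
def IsSpectralMeasureOf (U : H →L[ℂ] H) (E : Set Circle → H →L[ℂ] H) : Prop :=
  ∃ hE : IsSpectralMeasure E, ∀ x y : H,
    inner ℂ y (U x) =
      (elementaryMeasure hE x y).integral (fun ξ : Circle => (ξ : ℂ)) (ContinuousLinearMap.mul ℝ ℂ)

/-- `E` is the spectral measure of `U`: it is associated with `U`, and every spectral measure
associated with `U` agrees with `E` on all Borel sets. -/
def IsTheSpectralMeasureOf (U : H →L[ℂ] H) (E : Set Circle → H →L[ℂ] H) : Prop :=
  IsSpectralMeasureOf U E ∧
    ∀ F : Set Circle → H →L[ℂ] H, IsSpectralMeasureOf U F →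
      ∀ Ω, MeasurableSet Ω → F Ω = E Ω

/-- The reflected operator-valued set function `E^c(Ω) = E(Ω^*)`. -/
def reflect (E : Set Circle → H →L[ℂ] H) : Set Circle → H →L[ℂ] H :=
  fun Ω => E (conjSet Ω)

end SpectralConj

end

/-! Everything rests on the fact that an operator and a spectral measure associated with it
determine each other. One direction is immediate from the weak integral. For the other,
`IsSpectralMeasureOf.unique`, a spectral measure is multiplicative on intersections, so integration
of bounded functions respects sums, products and conjugation. Two spectral measures of `U` thus give
equal integrals on a star algebra containing `ξ`. It separates points, so the finite measures
`‖E(Ω)x‖²` coincide, and polarization recovers `E(Ω)`. Reflection pushes `E` forward under `ξ ↦ ξ⁻¹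
= conj ξ`, giving `U*`. Conjugation by `C` conjugates the elementary measures, giving `CU*C`. Both
equivalences then compare operators with spectral measures: `CUC = U*` means `CU*C = U`, and `CUC =
U` means `CU*C = U*`. -/

namespace MeasureTheory

/-! ### Integrals of bounded functions against complex measures -/

/-- Bounded pointwise limits and sums of multiples of indicators exhaust the bounded measurable
functions. -/
theorem bounded_measurable_induction {X : Type*} [MeasurableSpace X] {P : (X → ℂ) → Prop}
    (ind : ∀ (c : ℂ) (s : Set X), MeasurableSet s → P (s.indicator fun _ => c))
    (add : ∀ f g : X → ℂ, Measurable f → Measurable g → (∃ M, ∀ x, ‖f x‖ ≤ M) →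
      (∃ M, ∀ x, ‖g x‖ ≤ M) → P f → P g → P (f + g))
    (lim : ∀ (F : ℕ → X → ℂ) (f : X → ℂ) (M : ℝ), (∀ n, Measurable (F n)) →
      (∀ n x, ‖F n x‖ ≤ M) → (∀ x, Filter.Tendsto (fun n => F n x) Filter.atTop (nhds (f x))) →
      (∀ n, P (F n)) → P f)
    {f : X → ℂ} (hf : Measurable f) {M : ℝ} (hM : ∀ x, ‖f x‖ ≤ M) : P f := by
  have simple : ∀ g : SimpleFunc X ℂ, P g := fun g => by
    induction g using SimpleFunc.induction with
    | const c hs => simpa [SimpleFunc.coe_piecewise, Set.piecewise_eq_indicator] using! ind c _ hs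
    | @add f g _ h₁ h₂ =>
      exact add _ _ f.measurable g.measurable f.exists_forall_norm_le g.exists_forall_norm_le h₁ h₂
  -- A point of `X` forces `0 ≤ M`, which the norm bound on the approximants needs.
  rcases isEmpty_or_nonempty X with hX | ⟨⟨x₀⟩⟩
  · rw [Subsingleton.elim f (SimpleFunc.const X 0)]
    exact simple _
  have hM0 : 0 ≤ M := (norm_nonneg _).trans (hM x₀)
  have hs := hf.stronglyMeasurable
  exact lim (fun n => hs.approxBounded M n) f M (fun n => (hs.approxBounded M n).measurable)
    (fun n x => hs.norm_approxBounded_le hM0 n x)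
    (fun x => hs.tendsto_approxBounded_of_norm_le (hM x)) (fun n => simple _)

namespace ComplexMeasure

variable {X : Type*} [MeasurableSpace X]

/-- The variation is dominated by the total variations of the real and imaginary parts. Finiteness
makes bounded measurable functions integrable. -/
instance isFiniteMeasure_variation (μ : ComplexMeasure X) : IsFiniteMeasure μ.variation := by
  refine isFiniteMeasure_of_le
    ((ComplexMeasure.re μ).totalVariation + (ComplexMeasure.im μ).totalVariation) ?_
  refine VectorMeasure.variation_le_of_forall_enorm_le fun s _ => ?_
  rw [Measure.add_apply]
  calc ‖μ s‖ₑ ≤ ‖(μ s).re‖ₑ + ‖(μ s).im‖ₑ := by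
        simp only [← ofReal_norm]
        rw [← ENNReal.ofReal_add (norm_nonneg _) (norm_nonneg _)]
        exact ENNReal.ofReal_le_ofReal (Complex.norm_le_abs_re_add_abs_im _)
    _ ≤ _ := add_le_add (SignedMeasure.enorm_le_totalVariation (ComplexMeasure.re μ) s)
        (SignedMeasure.enorm_le_totalVariation (ComplexMeasure.im μ) s)

theorem integrable_of_bounded (μ : ComplexMeasure X) {f : X → ℂ} (hf : Measurable f) {M : ℝ}
    (hM : ∀ x, ‖f x‖ ≤ M) : μ.Integrable f :=
  MeasureTheory.Integrable.of_bound hf.aestronglyMeasurable M (Filter.Eventually.of_forall hM)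

theorem tendsto_integral_of_bounded (μ : ComplexMeasure X) {F : ℕ → X → ℂ} {f : X → ℂ} {M : ℝ}
    (hF : ∀ n, Measurable (F n)) (hM : ∀ n x, ‖F n x‖ ≤ M)
    (hlim : ∀ x, Filter.Tendsto (fun n => F n x) Filter.atTop (nhds (f x))) :
    Filter.Tendsto (fun n => μ.integral (F n) (ContinuousLinearMap.mul ℝ ℂ)) Filter.atTop
      (nhds (μ.integral f (ContinuousLinearMap.mul ℝ ℂ))) :=
  VectorMeasure.tendsto_integral_filter_of_norm_le_const
    (Filter.Eventually.of_forall fun n => (hF n).aestronglyMeasurable)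
    ⟨M, Filter.Eventually.of_forall fun n => Filter.Eventually.of_forall (hM n)⟩
    (Filter.Eventually.of_forall hlim)

theorem integral_indicator_const (μ : ComplexMeasure X) (c : ℂ) {s : Set X}
    (hs : MeasurableSet s) :
    μ.integral (s.indicator fun _ => c) (ContinuousLinearMap.mul ℝ ℂ) = c * μ s := by
  rw [VectorMeasure.integral_indicator hs, VectorMeasure.integral_const]
  simp

/-- Conjugating both the integrand and the measure conjugates the integral. -/
theorem integral_conj {μ ν : ComplexMeasure X} (h : ∀ s, MeasurableSet s → ν s = conj (μ s))
    {f : X → ℂ} (hf : Measurable f) {M : ℝ} (hM : ∀ x, ‖f x‖ ≤ M) :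
    ν.integral (fun x => conj (f x)) (ContinuousLinearMap.mul ℝ ℂ) =
      conj (μ.integral f (ContinuousLinearMap.mul ℝ ℂ)) := by
  have hc : Measurable (conj : ℂ → ℂ) := Complex.continuous_conj.measurable
  refine bounded_measurable_induction (P := fun f =>
    ν.integral (fun x => conj (f x)) (ContinuousLinearMap.mul ℝ ℂ) =
      conj (μ.integral f (ContinuousLinearMap.mul ℝ ℂ))) ?_ ?_ ?_ hf hM
  · intro c s hs
    have : (fun x => conj (s.indicator (fun _ => c) x)) = s.indicator fun _ => conj c := by
      ext x
      by_cases hx : x ∈ s <;> simp [hx]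
    rw [this, integral_indicator_const _ _ hs, integral_indicator_const _ _ hs, h s hs, map_mul]
  · rintro f g hf hg ⟨M, hM⟩ ⟨N, hN⟩ h₁ h₂
    have : (fun x => conj ((f + g) x)) = (fun x => conj (f x)) + fun x => conj (g x) := by
      ext x
      simp
    rw [this, VectorMeasure.integral_add, VectorMeasure.integral_add, h₁, h₂, map_add]
    · exact integrable_of_bounded _ hf hM
    · exact integrable_of_bounded _ hg hN
    · exact integrable_of_bounded _ (hc.comp hf) (M := M) (by simpa using hM)
    · exact integrable_of_bounded _ (hc.comp hg) (M := N) (by simpa using hN)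
  · intro F f M hF hM hlim hP
    have h₁ := tendsto_integral_of_bounded ν (F := fun n x => conj (F n x)) (M := M)
      (fun n => hc.comp (hF n)) (by simpa using hM)
      (fun x => (Complex.continuous_conj.tendsto _).comp (hlim x))
    have h₂ := (Complex.continuous_conj.tendsto _).comp (tendsto_integral_of_bounded μ hF hM hlim)
    simp only [hP] at h₁
    exact tendsto_nhds_unique h₁ h₂

/-- The pairing is only declared real-bilinear, so complex homogeneity is checked on indicators and
extended. -/
theorem integral_const_mul (μ : ComplexMeasure X) (c : ℂ) {f : X → ℂ} (hf : Measurable f) {K : ℝ}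
    (hK : ∀ x, ‖f x‖ ≤ K) :
    μ.integral (fun x => c * f x) (ContinuousLinearMap.mul ℝ ℂ) =
      c * μ.integral f (ContinuousLinearMap.mul ℝ ℂ) := by
  refine bounded_measurable_induction (P := fun f =>
    μ.integral (fun x => c * f x) (ContinuousLinearMap.mul ℝ ℂ) =
      c * μ.integral f (ContinuousLinearMap.mul ℝ ℂ)) ?_ ?_ ?_ hf hK
  · intro d s hs
    have : (fun x => c * s.indicator (fun _ => d) x) = s.indicator fun _ => c * d := by
      ext x
      by_cases hx : x ∈ s <;> simp [hx]
    rw [this, integral_indicator_const _ _ hs, integral_indicator_const _ _ hs, mul_assoc]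
  · rintro f g hf hg ⟨M, hM⟩ ⟨N, hN⟩ h₁ h₂
    have : (fun x => c * (f + g) x) = (fun x => c * f x) + fun x => c * g x := by
      ext x
      simp [mul_add]
    rw [this, VectorMeasure.integral_add, VectorMeasure.integral_add, h₁, h₂, mul_add]
    · exact integrable_of_bounded _ hf hM
    · exact integrable_of_bounded _ hg hN
    · refine integrable_of_bounded _ (hf.const_mul c) (M := ‖c‖ * M) fun x => ?_
      rw [norm_mul]
      gcongr
      exact hM x
    · refine integrable_of_bounded _ (hg.const_mul c) (M := ‖c‖ * N) fun x => ?_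
      rw [norm_mul]
      gcongr
      exact hN x
  · intro F f M hF hM hlim hP
    have h₁ := tendsto_integral_of_bounded μ (F := fun n x => c * F n x) (M := ‖c‖ * M)
      (fun n => (hF n).const_mul c)
      (fun n x => by rw [norm_mul]; gcongr; exact hM n x)
      (fun x => (hlim x).const_mul c)
    simp only [hP] at h₁
    exact tendsto_nhds_unique h₁ ((tendsto_integral_of_bounded μ hF hM hlim).const_mul c)

/-- Integration against a complex measure with a bounded density. -/
theorem integral_of_density {μ ν : ComplexMeasure X} {f : X → ℂ} (hf : Measurable f) {K : ℝ}
    (hK : ∀ x, ‖f x‖ ≤ K)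
    (h : ∀ s, MeasurableSet s →
      ν s = (μ.restrict s).integral f (ContinuousLinearMap.mul ℝ ℂ))
    {g : X → ℂ} (hg : Measurable g) {M : ℝ} (hM : ∀ x, ‖g x‖ ≤ M) :
    ν.integral g (ContinuousLinearMap.mul ℝ ℂ) =
      μ.integral (fun x => g x * f x) (ContinuousLinearMap.mul ℝ ℂ) := by
  have bdd : ∀ {g : X → ℂ} {M : ℝ}, (∀ x, ‖g x‖ ≤ M) → ∀ x, ‖g x * f x‖ ≤ M * K := by
    intro g M hM x
    rw [norm_mul]
    exact mul_le_mul (hM x) (hK x) (norm_nonneg _) ((norm_nonneg _).trans (hM x))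
  refine bounded_measurable_induction (P := fun g =>
    ν.integral g (ContinuousLinearMap.mul ℝ ℂ) =
      μ.integral (fun x => g x * f x) (ContinuousLinearMap.mul ℝ ℂ)) ?_ ?_ ?_ hg hM
  · intro c s hs
    have : (fun x => s.indicator (fun _ => c) x * f x) = s.indicator fun x => c * f x := by
      ext x
      by_cases hx : x ∈ s <;> simp [hx]
    rw [this, integral_indicator_const _ _ hs, VectorMeasure.integral_indicator hs,
      integral_const_mul _ c hf hK, h s hs]
  · rintro g₁ g₂ hg₁ hg₂ ⟨M, hM⟩ ⟨N, hN⟩ h₁ h₂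
    have : (fun x => (g₁ + g₂) x * f x) = (fun x => g₁ x * f x) + fun x => g₂ x * f x := by
      ext x
      simp [add_mul]
    rw [this, VectorMeasure.integral_add, VectorMeasure.integral_add, h₁, h₂]
    · exact integrable_of_bounded _ (hg₁.mul hf) (bdd hM)
    · exact integrable_of_bounded _ (hg₂.mul hf) (bdd hN)
    · exact integrable_of_bounded _ hg₁ hM
    · exact integrable_of_bounded _ hg₂ hN
  · intro F g M hF hM hlim hP
    have h₁ := tendsto_integral_of_bounded μ (F := fun n x => F n x * f x) (M := M * K)
      (fun n => (hF n).mul hf) (fun n => bdd (hM n)) (fun x => (hlim x).mul_const (f x))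
    have h₂ := tendsto_integral_of_bounded ν hF hM hlim
    simp only [hP] at h₂
    exact tendsto_nhds_unique h₂ h₁

/-- For a complex measure that comes from a finite positive measure, the integral is the Bochner
integral. -/
theorem integral_eq_integral_of_measure {μ : ComplexMeasure X} {P : Measure X}
    [IsFiniteMeasure P] (h : ∀ s, MeasurableSet s → μ s = (P.real s : ℂ))
    {f : X → ℂ} (hf : Measurable f) {M : ℝ} (hM : ∀ x, ‖f x‖ ≤ M) :
    μ.integral f (ContinuousLinearMap.mul ℝ ℂ) = ∫ x, f x ∂P := by
  refine bounded_measurable_induction (P := fun f =>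
    μ.integral f (ContinuousLinearMap.mul ℝ ℂ) = ∫ x, f x ∂P) ?_ ?_ ?_ hf hM
  · intro c s hs
    rw [integral_indicator_const _ _ hs, MeasureTheory.integral_indicator_const _ hs, h s hs,
      Complex.real_smul, mul_comm]
  · rintro f g hf hg ⟨M, hM⟩ ⟨N, hN⟩ h₁ h₂
    rw [VectorMeasure.integral_add (integrable_of_bounded _ hf hM) (integrable_of_bounded _ hg hN),
      h₁, h₂]
    exact (integral_add
      (.of_bound hf.aestronglyMeasurable M (Filter.Eventually.of_forall hM))
      (.of_bound hg.aestronglyMeasurable N (Filter.Eventually.of_forall hN))).symm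
  · intro F f M hF hM hlim hP
    have h₁ := tendsto_integral_of_bounded μ hF hM hlim
    simp only [hP] at h₁
    exact tendsto_nhds_unique h₁ (tendsto_integral_of_dominated_convergence (fun _ => M)
      (fun n => (hF n).aestronglyMeasurable) (integrable_const M)
      (fun n => Filter.Eventually.of_forall (hM n)) (Filter.Eventually.of_forall hlim))

end ComplexMeasure

end MeasureTheory

namespace SpectralConj

instance : SecondCountableTopology Circle :=
  inferInstanceAs (SecondCountableTopology (Submonoid.unitSphere ℂ))

theorem measurable_coe_circle : Measurable (fun ξ : Circle => (ξ : ℂ)) :=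
  have h : Continuous fun ξ : Circle => (ξ : ℂ) := continuous_subtype_val
  h.measurable

variable {H : Type*} [NormedAddCommGroup H] [InnerProductSpace ℂ H]

/-! ### Conjugations -/

namespace IsConjugation

variable {C : H →L⋆[ℂ] H}

/-- Polarization: antilinearity exchanges the two terms carrying `±i`, and this conjugates the inner
product. -/
theorem inner_map_map (hC : IsConjugation C) (x y : H) : inner ℂ (C x) (C y) = inner ℂ y x := by
  have h₁ : C x + C y = C (x + y) := (map_add C x y).symm
  have h₂ : C x - C y = C (x - y) := (map_sub C x y).symm
  have h₃ : C x - Complex.I • C y = C (x + Complex.I • y) := by simp [sub_eq_add_neg]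
  have h₄ : C x + Complex.I • C y = C (x - Complex.I • y) := by simp [sub_eq_add_neg]
  rw [← inner_conj_symm y x, inner_eq_sum_norm_sq_div_four, inner_eq_sum_norm_sq_div_four x y]
  simp only [RCLike.I_to_complex, h₁, h₂, h₃, h₄, hC.isometric]
  have h4 : conj (4 : ℂ) = 4 := Complex.conj_ofNat 4
  simp [h4]
  ring

theorem inner_map_left (hC : IsConjugation C) (x y : H) :
    inner ℂ (C x) y = inner ℂ (C y) x := by
  rw [← hC.inner_map_map x (C y), hC.involutive]

theorem inner_map_right (hC : IsConjugation C) (x y : H) :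
    inner ℂ x (C y) = inner ℂ y (C x) := by
  rw [← inner_conj_symm, hC.inner_map_left, inner_conj_symm]

theorem inner_sandwich (hC : IsConjugation C) (A : H →L[ℂ] H) (x y : H) :
    inner ℂ y (sandwich C A x) = conj (inner ℂ (C y) (A (C x))) := by
  rw [inner_conj_symm]
  exact hC.inner_map_right y (A (C x))

theorem sandwich_sandwich (hC : IsConjugation C) (A : H →L[ℂ] H) :
    sandwich C (sandwich C A) = A := by
  ext x
  simp [sandwich, hC.involutive]

theorem adjoint_sandwich [CompleteSpace H] (hC : IsConjugation C) (A : H →L[ℂ] H) :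
    ContinuousLinearMap.adjoint (sandwich C A) = sandwich C (ContinuousLinearMap.adjoint A) := by
  refine ContinuousLinearMap.ext fun x => ext_inner_left ℂ fun y => ?_
  rw [ContinuousLinearMap.adjoint_inner_right, hC.inner_sandwich,
    ContinuousLinearMap.adjoint_inner_right, inner_conj_symm, ← inner_conj_symm, hC.inner_sandwich,
    RingHomCompTriple.comp_apply]
  simp

end IsConjugation

/-! ### Multiplicativity of spectral measures and their elementary measures -/

variable [CompleteSpace H] {E F : Set Circle → H →L[ℂ] H} {T S U : H →L[ℂ] H} {f g : Circle → ℂ}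

theorem elementaryMeasure_apply (hE : IsSpectralMeasure E) (x y : H) {Ω : Set Circle}
    (hΩ : MeasurableSet Ω) : elementaryMeasure hE x y Ω = inner ℂ y (E Ω x) :=
  if_pos hΩ

namespace IsSpectralMeasure

theorem inner_apply_left (hE : IsSpectralMeasure E) {Ω : Set Circle} (hΩ : MeasurableSet Ω)
    (x y : H) : inner ℂ (E Ω x) y = inner ℂ x (E Ω y) := by
  rw [← ContinuousLinearMap.adjoint_inner_right, ← ContinuousLinearMap.star_eq_adjoint,
    (hE.isStarProjection Ω hΩ).isSelfAdjoint.star_eq]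

theorem union (hE : IsSpectralMeasure E) {A B : Set Circle} (hA : MeasurableSet A)
    (hB : MeasurableSet B) (hAB : Disjoint A B) : E (A ∪ B) = E A + E B := by
  refine ContinuousLinearMap.ext fun x => ext_inner_left ℂ fun y => ?_
  have := (elementaryMeasure hE x y).of_union hAB hA hB
  rw [elementaryMeasure_apply hE x y hA, elementaryMeasure_apply hE x y hB,
    elementaryMeasure_apply hE x y (hA.union hB)] at this
  rw [this, add_apply, inner_add_right]

/-- Write `P`, `Q` for the two projections. Since `P + Q` is idempotent, `PQ + QP = 0`. Multiplying
by `P` on either side gives `PQ = -PQP = QP`, so `2PQ = 0`. -/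
theorem mul_eq_zero (hE : IsSpectralMeasure E) {A B : Set Circle} (hA : MeasurableSet A)
    (hB : MeasurableSet B) (hAB : Disjoint A B) : E A * E B = 0 := by
  have hP : E A * E A = E A := (hE.isStarProjection A hA).isIdempotentElem
  have hQ : E B * E B = E B := (hE.isStarProjection B hB).isIdempotentElem
  have hU := (hE.isStarProjection _ (hA.union hB)).isIdempotentElem.eq
  rw [hE.union hA hB hAB] at hU
  have anti : E A * E B + E B * E A = 0 := by
    have : (E A + E B) * (E A + E B) = E A * E A + E B * E B + (E A * E B + E B * E A) := by
      noncomm_ring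
    rw [this, hP, hQ] at hU
    simpa using hU
  have h₁ : E A * E B + E A * E B * E A = 0 := by
    calc _ = E A * E A * E B + E A * E B * E A := by rw [hP]
      _ = E A * (E A * E B + E B * E A) := by noncomm_ring
      _ = 0 := by rw [anti, mul_zero]
  have h₂ : E A * E B * E A + E B * E A = 0 := by
    calc _ = E A * E B * E A + E B * (E A * E A) := by rw [hP]
      _ = (E A * E B + E B * E A) * E A := by noncomm_ring
      _ = 0 := by rw [anti, zero_mul]
  have h₃ : E A * E B = E B * E A := by
    rw [eq_neg_of_add_eq_zero_left h₁, eq_neg_of_add_eq_zero_right h₂]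
  rw [← h₃, ← two_smul ℂ] at anti
  exact (smul_eq_zero.mp anti).resolve_left two_ne_zero

theorem inter (hE : IsSpectralMeasure E) {A B : Set Circle} (hA : MeasurableSet A)
    (hB : MeasurableSet B) : E (A ∩ B) = E A * E B := by
  have hI := hA.inter hB
  have h₁ : E A = E (A ∩ B) + E (A \ B) := by
    rw [← hE.union hI (hA.diff hB) Set.disjoint_sdiff_inter.symm, Set.inter_union_sdiff]
  have h₂ : E B = E (A ∩ B) + E (B \ A) := by
    rw [Set.inter_comm, ← hE.union (hB.inter hA) (hB.diff hA) Set.disjoint_sdiff_inter.symm,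
      Set.inter_union_sdiff]
  -- Of the four products only the square of `E (A ∩ B)` survives; the others involve disjoint sets.
  rw [h₁, h₂, add_mul, mul_add, mul_add,
    hE.mul_eq_zero hI (hB.diff hA) (by
      rw [Set.disjoint_left]; exact fun x h h' => h'.2 h.1),
    hE.mul_eq_zero (hA.diff hB) hI (by
      rw [Set.disjoint_left]; exact fun x h h' => h.2 h'.2),
    hE.mul_eq_zero (hA.diff hB) (hB.diff hA) (by
      rw [Set.disjoint_left]; exact fun x h h' => h.2 h'.1)]
  simpa using (hE.isStarProjection _ hI).isIdempotentElem.eq.symm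

theorem elementaryMeasure_restrict (hE : IsSpectralMeasure E) (x y : H) {Ω : Set Circle}
    (hΩ : MeasurableSet Ω) :
    (elementaryMeasure hE x y).restrict Ω = elementaryMeasure hE x (E Ω y) := by
  refine VectorMeasure.ext fun s hs => ?_
  rw [VectorMeasure.restrict_apply _ hΩ hs, elementaryMeasure_apply hE _ _ (hs.inter hΩ),
    elementaryMeasure_apply hE _ _ hs, hE.inner_apply_left hΩ, Set.inter_comm, hE.inter hΩ hs]
  rfl

theorem elementaryMeasure_swap (hE : IsSpectralMeasure E) (x y : H) {Ω : Set Circle}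
    (hΩ : MeasurableSet Ω) : elementaryMeasure hE x y Ω = conj (elementaryMeasure hE y x Ω) := by
  rw [elementaryMeasure_apply hE _ _ hΩ, elementaryMeasure_apply hE _ _ hΩ, inner_conj_symm,
    hE.inner_apply_left hΩ]

theorem elementaryMeasure_self (hE : IsSpectralMeasure E) (x : H) {Ω : Set Circle}
    (hΩ : MeasurableSet Ω) : elementaryMeasure hE x x Ω = ((‖E Ω x‖ ^ 2 : ℝ) : ℂ) := by
  have h : E Ω (E Ω x) = E Ω x :=
    congrArg (fun A : H →L[ℂ] H => A x) (hE.isStarProjection Ω hΩ).isIdempotentElem.eq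
  rw [elementaryMeasure_apply hE _ _ hΩ, ← h, ← hE.inner_apply_left hΩ, h,
    inner_self_eq_norm_sq_to_K]
  simp

theorem zero_le_re_elementaryMeasure_self (hE : IsSpectralMeasure E) (x : H) :
    0 ≤[Set.univ] ComplexMeasure.re (elementaryMeasure hE x x) := by
  refine VectorMeasure.restrict_le_restrict_of_subset_le _ _ fun s hs _ => ?_
  change 0 ≤ (elementaryMeasure hE x x s).re
  rw [hE.elementaryMeasure_self x hs, Complex.ofReal_re]
  positivity

/-- The positive measure `Ω ↦ ‖E(Ω) x‖ ^ 2`. -/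
noncomputable def diagonalMeasure (hE : IsSpectralMeasure E) (x : H) : Measure Circle :=
  (ComplexMeasure.re (elementaryMeasure hE x x)).toMeasureOfZeroLE Set.univ .univ
    (hE.zero_le_re_elementaryMeasure_self x)

instance (hE : IsSpectralMeasure E) (x : H) : IsFiniteMeasure (hE.diagonalMeasure x) :=
  SignedMeasure.toMeasureOfZeroLE_finite _ _ _

theorem elementaryMeasure_self_eq_diagonalMeasure (hE : IsSpectralMeasure E) (x : H)
    {Ω : Set Circle} (hΩ : MeasurableSet Ω) :
    elementaryMeasure hE x x Ω = ((hE.diagonalMeasure x).real Ω : ℂ) := by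
  rw [diagonalMeasure, SignedMeasure.toMeasureOfZeroLE_real_apply _ _ _ hΩ, Set.univ_inter]
  change _ = ((elementaryMeasure hE x x Ω).re : ℂ)
  rw [hE.elementaryMeasure_self x hΩ, Complex.ofReal_re]

end IsSpectralMeasure

/-! ### Functional calculus in the weak sense -/

/-- `T` is the integral `∫ f dE` of the bounded Borel function `f`, in the weak sense. -/
structure Represents (hE : IsSpectralMeasure E) (T : H →L[ℂ] H) (f : Circle → ℂ) : Prop where
  measurable : Measurable f
  bounded : ∃ M : ℝ, ∀ ξ, ‖f ξ‖ ≤ M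
  inner_eq : ∀ x y : H, inner ℂ y (T x) =
    (elementaryMeasure hE x y).integral f (ContinuousLinearMap.mul ℝ ℂ)

namespace Represents

variable {hE : IsSpectralMeasure E}

theorem const (hE : IsSpectralMeasure E) (c : ℂ) :
    Represents hE (algebraMap ℂ (H →L[ℂ] H) c) (fun _ => c) where
  measurable := measurable_const
  bounded := ⟨‖c‖, fun _ => le_rfl⟩
  inner_eq x y := by
    rw [VectorMeasure.integral_const, elementaryMeasure_apply hE _ _ .univ, hE.univ_eq]
    simp [Algebra.algebraMap_eq_smul_one]

theorem add (hT : Represents hE T f) (hS : Represents hE S g) :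
    Represents hE (T + S) (f + g) where
  measurable := hT.measurable.add hS.measurable
  bounded := by
    obtain ⟨M, hM⟩ := hT.bounded
    obtain ⟨N, hN⟩ := hS.bounded
    exact ⟨M + N, fun ξ => norm_add_le_of_le (hM ξ) (hN ξ)⟩
  inner_eq x y := by
    obtain ⟨M, hM⟩ := hT.bounded
    obtain ⟨N, hN⟩ := hS.bounded
    rw [VectorMeasure.integral_add (ComplexMeasure.integrable_of_bounded _ hT.measurable hM)
      (ComplexMeasure.integrable_of_bounded _ hS.measurable hN), add_apply,
      inner_add_right]
    exact congrArg₂ _ (hT.inner_eq x y) (hS.inner_eq x y)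

/-- The measure `μ_{Sx,y}` has density `g` with respect to `μ_{x,y}`: moving `E(s)` onto `y`
restricts `μ_{x,y}` to `s`. -/
theorem mul (hT : Represents hE T f) (hS : Represents hE S g) :
    Represents hE (T * S) (fun ξ => f ξ * g ξ) where
  measurable := hT.measurable.mul hS.measurable
  bounded := by
    obtain ⟨M, hM⟩ := hT.bounded
    obtain ⟨N, hN⟩ := hS.bounded
    exact ⟨M * N, fun ξ => norm_mul_le_of_le (hM ξ) (hN ξ)⟩
  inner_eq x y := by
    obtain ⟨M, hM⟩ := hT.bounded
    obtain ⟨N, hN⟩ := hS.bounded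
    rw [← ComplexMeasure.integral_of_density (ν := elementaryMeasure hE (S x) y) hS.measurable hN
      (fun s hs => ?_) hT.measurable hM]
    · exact hT.inner_eq (S x) y
    · rw [hE.elementaryMeasure_restrict x y hs, ← hS.inner_eq, hE.inner_apply_left hs,
        elementaryMeasure_apply hE _ _ hs]

theorem adjoint (hT : Represents hE T f) :
    Represents hE (ContinuousLinearMap.adjoint T) (fun ξ => conj (f ξ)) where
  measurable := Complex.continuous_conj.measurable.comp hT.measurable
  bounded := by simpa using hT.bounded
  inner_eq x y := by
    obtain ⟨M, hM⟩ := hT.bounded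
    rw [ComplexMeasure.integral_conj (fun s hs => hE.elementaryMeasure_swap x y hs) hT.measurable
      hM, ← hT.inner_eq, ContinuousLinearMap.adjoint_inner_right, inner_conj_symm]

theorem of_isSpectralMeasureOf (h : IsSpectralMeasureOf U E) :
    Represents h.choose U (fun ξ : Circle => (ξ : ℂ)) where
  measurable := measurable_coe_circle
  bounded := ⟨1, fun ξ => (Circle.norm_coe ξ).le⟩
  inner_eq := h.choose_spec

theorem inner_self_eq (hT : Represents hE T f) (x : H) :
    inner ℂ x (T x) = ∫ ξ, f ξ ∂hE.diagonalMeasure x := by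
  obtain ⟨M, hM⟩ := hT.bounded
  rw [hT.inner_eq, ComplexMeasure.integral_eq_integral_of_measure
    (fun s hs => hE.elementaryMeasure_self_eq_diagonalMeasure x hs) hT.measurable hM]

end Represents

/-! ### Uniqueness -/

/-- The continuous functions that have the same integral with respect to `E` and `F`. -/
def commonIntegralSubalgebra (hE : IsSpectralMeasure E) (hF : IsSpectralMeasure F) :
    StarSubalgebra ℂ (BoundedContinuousFunction Circle ℂ) where
  carrier := {g | ∃ T, Represents hE T g ∧ Represents hF T g}
  mul_mem' := by
    rintro f g ⟨T, h₁, h₂⟩ ⟨S, h₃, h₄⟩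
    exact ⟨T * S, h₁.mul h₃, h₂.mul h₄⟩
  add_mem' := by
    rintro f g ⟨T, h₁, h₂⟩ ⟨S, h₃, h₄⟩
    exact ⟨T + S, h₁.add h₃, h₂.add h₄⟩
  algebraMap_mem' c := ⟨algebraMap ℂ (H →L[ℂ] H) c, .const hE c, .const hF c⟩
  star_mem' := by
    rintro f ⟨T, h₁, h₂⟩
    exact ⟨ContinuousLinearMap.adjoint T, h₁.adjoint, h₂.adjoint⟩

theorem IsSpectralMeasureOf.unique (hE : IsSpectralMeasureOf U E) (hF : IsSpectralMeasureOf U F)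
    {Ω : Set Circle} (hΩ : MeasurableSet Ω) : F Ω = E Ω := by
  have hE' := hE.choose
  have hF' := hF.choose
  have hdiag : ∀ x, hE'.diagonalMeasure x = hF'.diagonalMeasure x := fun x => by
    refine ext_of_forall_mem_subalgebra_integral_eq_of_polish
      (A := commonIntegralSubalgebra hE' hF') ?_ ?_
    · intro ξ ζ hne
      -- The coordinate function separates points and lies in the algebra because `U` represents it
      -- for both measures.
      let g : BoundedContinuousFunction Circle ℂ :=
        BoundedContinuousFunction.mkOfCompact ⟨fun ξ : Circle => (ξ : ℂ), continuous_subtype_val⟩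
      refine ⟨g, ⟨g.toContinuousMap, ⟨g, ⟨U, ?_, ?_⟩, rfl⟩, rfl⟩, fun h => hne (Circle.ext h)⟩
      · exact Represents.of_isSpectralMeasureOf hE
      · exact Represents.of_isSpectralMeasureOf hF
    · rintro g ⟨T, h₁, h₂⟩
      rw [← h₁.inner_self_eq, ← h₂.inner_self_eq]
  -- Over `ℂ`, an operator is determined by its quadratic form.
  rw [← ContinuousLinearMap.coe_inj, ← ext_inner_map]
  intro x
  have h := hE'.elementaryMeasure_self_eq_diagonalMeasure x hΩ
  rw [hdiag x, ← hF'.elementaryMeasure_self_eq_diagonalMeasure x hΩ,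
    elementaryMeasure_apply _ _ _ hΩ, elementaryMeasure_apply _ _ _ hΩ] at h
  change inner ℂ (F Ω x) x = inner ℂ (E Ω x) x
  rw [← inner_conj_symm, ← h, inner_conj_symm]

theorem IsSpectralMeasureOf.isTheSpectralMeasureOf (hE : IsSpectralMeasureOf U E) :
    IsTheSpectralMeasureOf U E :=
  ⟨hE, fun _ hF _ hΩ => hE.unique hF hΩ⟩

theorem IsSpectralMeasureOf.operator_unique (hT : IsSpectralMeasureOf T E)
    (hS : IsSpectralMeasureOf S F) (h : ∀ Ω, MeasurableSet Ω → E Ω = F Ω) : T = S := by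
  obtain ⟨hE, hT⟩ := hT
  obtain ⟨hF, hS⟩ := hS
  refine ContinuousLinearMap.ext fun x => ext_inner_left ℂ fun y => ?_
  rw [hT, hS, VectorMeasure.ext fun Ω hΩ => (?_ :
    elementaryMeasure hE x y Ω = elementaryMeasure hF x y Ω)]
  rw [elementaryMeasure_apply _ _ _ hΩ, elementaryMeasure_apply _ _ _ hΩ, h Ω hΩ]

/-! ### Reflected and conjugated spectral measures -/

theorem conjSet_eq_preimage (Ω : Set Circle) : conjSet Ω = (fun ξ => ξ⁻¹) ⁻¹' Ω := by
  ext ζ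
  constructor
  · rintro ⟨ξ, hξ, h⟩
    have : ζ⁻¹ = ξ := by
      rw [← inv_inv ξ, inv_inj]
      exact Circle.ext (by rw [h, Circle.coe_inv_eq_conj])
    simpa [this] using hξ
  · intro h
    exact ⟨ζ⁻¹, h, by rw [Circle.coe_inv_eq_conj, Complex.conj_conj]⟩

theorem measurable_inv_circle : Measurable fun ξ : Circle => ξ⁻¹ :=
  continuous_inv.measurable

theorem IsSpectralMeasure.reflect (hE : IsSpectralMeasure E) : IsSpectralMeasure (reflect E) where
  isStarProjection Ω hΩ := by
    rw [SpectralConj.reflect, conjSet_eq_preimage]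
    exact hE.isStarProjection _ (measurable_inv_circle hΩ)
  univ_eq := by
    rw [SpectralConj.reflect, conjSet_eq_preimage, Set.preimage_univ, hE.univ_eq]
  hasSum_iUnion Ω hΩ hd x := by
    simp only [SpectralConj.reflect, conjSet_eq_preimage, Set.preimage_iUnion]
    exact hE.hasSum_iUnion _ (fun n => measurable_inv_circle (hΩ n))
      (fun i j hij => (hd hij).preimage _) x

theorem IsSpectralMeasureOf.reflect (hE : IsSpectralMeasureOf U E) :
    IsSpectralMeasureOf (ContinuousLinearMap.adjoint U) (reflect E) := by
  have hE' := hE.choose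
  refine ⟨hE'.reflect, fun x y => ?_⟩
  have h : elementaryMeasure hE'.reflect x y =
      (elementaryMeasure hE' x y).map fun ξ : Circle => ξ⁻¹ := by
    refine VectorMeasure.ext fun Ω hΩ => ?_
    rw [VectorMeasure.map_apply _ measurable_inv_circle hΩ, elementaryMeasure_apply _ _ _ hΩ,
      elementaryMeasure_apply _ _ _ (measurable_inv_circle hΩ), SpectralConj.reflect,
      conjSet_eq_preimage]
  rw [(Represents.of_isSpectralMeasureOf hE).adjoint.inner_eq, h,
    VectorMeasure.integral_map measurable_inv_circle measurable_coe_circle.aestronglyMeasurable]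
  · simp only [Circle.coe_inv_eq_conj]
  · exact ComplexMeasure.integrable_of_bounded _
      (measurable_coe_circle.comp measurable_inv_circle) (M := 1) fun ξ => (Circle.norm_coe ξ⁻¹).le

theorem IsSpectralMeasure.sandwich {C : H →L⋆[ℂ] H} (hC : IsConjugation C)
    (hE : IsSpectralMeasure E) : IsSpectralMeasure fun Ω => sandwich C (E Ω) where
  isStarProjection Ω hΩ := by
    have hP := hE.isStarProjection Ω hΩ
    refine ⟨?_, ?_⟩
    · refine ContinuousLinearMap.ext fun x => ?_
      have h : E Ω (E Ω (C x)) = E Ω (C x) :=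
        congrArg (fun A : H →L[ℂ] H => A (C x)) hP.isIdempotentElem.eq
      simp [SpectralConj.sandwich, hC.involutive, h]
    · rw [IsSelfAdjoint, ContinuousLinearMap.star_eq_adjoint, hC.adjoint_sandwich,
        ← ContinuousLinearMap.star_eq_adjoint, hP.isSelfAdjoint.star_eq]
  univ_eq := by
    ext x
    simp [SpectralConj.sandwich, hE.univ_eq, hC.involutive]
  hasSum_iUnion Ω hΩ hd x := (hE.hasSum_iUnion Ω hΩ hd (C x)).map C C.continuous

/-- The adjoint appears because `⟨CE(Ω)Cx, y⟩` is the conjugate of `⟨E(Ω)Cx, Cy⟩`: integrating `ξ`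
against the former gives the conjugate of `∫ conj ξ` against the latter, that is, of `⟨U*Cx, Cy⟩`.
-/
theorem IsSpectralMeasureOf.sandwich {C : H →L⋆[ℂ] H} (hC : IsConjugation C)
    (hE : IsSpectralMeasureOf U E) :
    IsSpectralMeasureOf (sandwich C (ContinuousLinearMap.adjoint U))
      (fun Ω => sandwich C (E Ω)) := by
  have hE' := hE.choose
  have hU := (Represents.of_isSpectralMeasureOf hE).adjoint
  refine ⟨hE'.sandwich hC, fun x y => ?_⟩
  have h : ∀ Ω, MeasurableSet Ω → elementaryMeasure (hE'.sandwich hC) x y Ω =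
      conj (elementaryMeasure hE' (C x) (C y) Ω) := fun Ω hΩ => by
    rw [elementaryMeasure_apply _ _ _ hΩ, elementaryMeasure_apply _ _ _ hΩ, hC.inner_sandwich]
  obtain ⟨M, hM⟩ := hU.bounded
  rw [hC.inner_sandwich, hU.inner_eq, ← ComplexMeasure.integral_conj h hU.measurable hM]
  simp only [Complex.conj_conj]

end SpectralConj

theorem proposition4 {H : Type*} [NormedAddCommGroup H] [InnerProductSpace ℂ H] [CompleteSpace H]
    [TopologicalSpace.SeparableSpace H]
    (C : H →L⋆[ℂ] H) (hC : SpectralConj.IsConjugation C)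
    (U : H →L[ℂ] H) (hU : U ∈ unitary (H →L[ℂ] H))
    (E : Set Circle → H →L[ℂ] H) (hE : SpectralConj.IsSpectralMeasureOf U E) :
    SpectralConj.IsTheSpectralMeasureOf (ContinuousLinearMap.adjoint U) (SpectralConj.reflect E) ∧
    SpectralConj.IsTheSpectralMeasureOf
      (SpectralConj.sandwich C (ContinuousLinearMap.adjoint U))
      (fun Ω => SpectralConj.sandwich C (E Ω)) ∧
    (SpectralConj.sandwich C U = ContinuousLinearMap.adjoint U ↔
      ∀ Ω : Set Circle, MeasurableSet Ω → SpectralConj.sandwich C (E Ω) = E Ω) ∧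
    (SpectralConj.sandwich C U = U ↔
      ∀ Ω : Set Circle, MeasurableSet Ω →
        SpectralConj.sandwich C (E Ω) = SpectralConj.reflect E Ω) := by
  have hR := hE.reflect
  have hS := hE.sandwich hC
  refine ⟨hR.isTheSpectralMeasureOf, hS.isTheSpectralMeasureOf, ⟨fun h Ω hΩ => ?_, fun h => ?_⟩,
    ⟨fun h Ω hΩ => ?_, fun h => ?_⟩⟩
  -- Here `CU*C = C(CUC)C = U`, so `hS` concerns `U` itself.
  · rw [← h, hC.sandwich_sandwich] at hS
    exact hE.unique hS hΩ
  · rw [← hC.sandwich_sandwich (ContinuousLinearMap.adjoint U), hS.operator_unique hE h]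
  -- Here `CU*C = (CUC)* = U*`, the operator of the reflected measure.
  · rw [← hC.adjoint_sandwich, h] at hS
    exact hR.unique hS hΩ
  · have := hS.operator_unique hR h
    rw [← hC.adjoint_sandwich] at this
    exact ContinuousLinearMap.adjoint.injective this
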